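/- Normalize the Fourier transform by $\widehat f(\xi)=\frac1{\sqrt{2\pi}}\int_{\mathbb R}f(x)e^{-i\xi x}\,dx$, extended to an isometry of $L_2(\mathbb R)$, and identify the torus $\mathbb T$ with $[-\pi,\pi)$. Say that $\psi:\mathbb R\to\mathbb C$ satisfies (A1) and (A2) if (A1) $\psi\in L_2(\mathbb R)$ is positive definite, i.e. $\sum_{i,j}c_i\overline{c_j}\,\psi(x_i-x_j)\ge 0$ for all finite families of $x_i\in\mathbb R$, $c_i\in\mathbb C$; (A2) $\sum_{j\in\mathbb Z}\|\widehat\psi(\cdot+2\pi j)\|_{L_\infty(\mathbb T)}<\infty$, $\ \delta_\psi:=\operatorname{ess\,inf}_{\xi\in\mathbb T}|\widehat\psi(\xi)|>0$, and hence $C_\psi:=\delta_\psi^{-1}\sum_{j\neq0}\|\widehat\psi(\cdot+2\pi j)\|_{L_\infty(\mathbb T)}<\infty$. For such $\psi$, $k\in\mathbb Z$ and $g\in L_2(\mathbb T)$ put $M_\psi g:=\frac{\delta_\psi}{\widehat\psi}\,g$ and $T_{\psi,k}g:=\delta_\psi^{-1}\widehat\psi(\cdot+2\pi k)\,g$. For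 a sequence $X=(x_j)_{j\in\mathbb Z}\subset\mathbb R$ such that $(e^{-ix_j\cdot})_{j\in\mathbb Z}$ is a Riesz basis of $L_2(\mathbb T)$, let $A_X^k$ be the operator on $L_2(\mathbb T)$ with $A_X^k\big(\sum_jc_je^{-ix_jt}\big)=\sum_jc_je^{-ix_j(t+2\pi k)}$ for $(c_j)\in\ell_2$; for $X=\mathbb Z$ (that is, $x_j=j$) this is the identity. Let $\psi$ satisfy (A1) and (A2), let $A$ be an index set with a preorder (for instance an unbounded set of positive reals), and let $(\phi_\alpha)_{\alpha\in A}$ be a family of functions $\mathbb R\to\mathbb C$ satisfying the following conditions with $X=Y=\mathbb Z$, where $\alpha\to\infty$ denotes the limit along the filter generated by the sets $\{\alpha\in A:\alpha\ge\alpha_0\}$, $\alpha_0\in A$: (B1) every $\phi_\alpha$ satisfies (A1) and (A2); (B2) $\sup_{\alpha\in A}C_{\phi_\alpha}<\infty$; (B3) $\lim_{\alpha\to\infty}\sum_{k\ne0}\|T_{\psi,k}A_X^k(M_\psi-M_{\phi_\alpha})g\|_{L_2(\mathbb T)}=0$ for every $g\in L_2(\mathbb T)$; (B4) $\lim_{\alpha\to\infty}\sum_{k\ne0}\|(T_{\phi_\alpha,k}A_Y^k-T_{\psi,k}A_X^k)M_{\phi_\alpha}g\|_{L_2(\mathbb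 T)}=0$ for every $g\in L_2(\mathbb T)$. For $\phi\in\{\psi\}\cup\{\phi_\alpha:\alpha\in A\}$ define the cardinal function $L_\phi$ by $$\widehat{L_\phi}(\xi):=\frac1{\sqrt{2\pi}}\,\frac{\widehat\phi(\xi)}{\sum_{j\in\mathbb Z}\widehat\phi(\xi+2\pi j)},\qquad L_\phi(x):=\frac1{\sqrt{2\pi}}\int_{\mathbb R}\widehat{L_\phi}(\xi)e^{i\xi x}\,d\xi .$$ Then these cardinal functions are well defined (the series in the denominator converges absolutely to a nonzero value for almost every $\xi$, and $\widehat{L_\phi}\in L_1(\mathbb R)$) and belong to $L_2(\mathbb R)$, and $L_{\phi_\alpha}\to L_\psi$ both uniformly on $\mathbb R$ and in $L_2(\mathbb R)$ as $\alpha\to\infty$. -/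

import Mathlib

open MeasureTheory Filter Topology
open scoped ENNReal

namespace CardinalInterpolation

noncomputable section

/-! ### The Fourier transform on `L₂(ℝ)` -/

open Classical in
/-- The Fourier transform of `f ∈ L₂(ℝ)` in the normalization
`f̂(ξ) = (2π)^(-1/2) ∫ f(x) e^(-iξx) dx`, extended to `L₂(ℝ)` by Plancherel.  It is obtained from
Mathlib's `L₂` transform, which extends `∫ f(x) e^(-2πiwx) dx`, by the substitution `w = ξ/(2π)`.
As an `L₂` function it is determined up to a null set.  (Value `0` if `f ∉ L₂(ℝ)`.) -/
def fhat (f : ℝ → ℂ) : ℝ → ℂ :=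
  if h : MemLp f 2 volume then
    fun ξ => ((Real.sqrt (2 * Real.pi))⁻¹ : ℂ) *
      (FourierTransform.fourier (h.toLp f) : Lp ℂ 2 (volume : Measure ℝ)) (ξ / (2 * Real.pi))
  else 0

/-! ### The torus, amalgam norm and generators -/

/-- Lebesgue measure on the torus `𝕋`, identified with `[-π, π)`. -/
abbrev torus : Measure ℝ := volume.restrict (Set.Ico (-Real.pi) Real.pi)

/-- The Hilbert space `L₂(𝕋)`. -/
abbrev L2T : Type := Lp ℂ 2 torus

/-- The norm `‖f(· + 2πj)‖_{L_∞(𝕋)}`. -/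
def blockSup (f : ℝ → ℂ) (j : ℤ) : ℝ≥0∞ :=
  eLpNorm (fun ξ => f (ξ + 2 * Real.pi * j)) ∞ torus

/-- The norm of the Wiener amalgam space `W(L_∞, ℓ₁)`. -/
def amalgamNorm (f : ℝ → ℂ) : ℝ≥0∞ := ∑' j : ℤ, blockSup f j

/-- Positive definiteness: `∑ᵢ ∑ⱼ cᵢ c̄ⱼ ψ(xᵢ - xⱼ)` is real and nonnegative. -/
def PositiveDefinite (ψ : ℝ → ℂ) : Prop :=
  ∀ (n : ℕ) (x : Fin n → ℝ) (c : Fin n → ℂ),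
    0 ≤ (∑ i, ∑ j, c i * (starRingEnd ℂ) (c j) * ψ (x i - x j)).re ∧
      (∑ i, ∑ j, c i * (starRingEnd ℂ) (c j) * ψ (x i - x j)).im = 0

/-- `δ_ψ`, the (essential) infimum of `|ψ̂|` over `𝕋`. -/
def delta (ψ : ℝ → ℂ) : ℝ≥0∞ := essInf (fun ξ => ‖fhat ψ ξ‖ₑ) torus

/-- `C_ψ = (∑_{j ≠ 0} ‖ψ̂(· + 2πj)‖_{L_∞(𝕋)}) / δ_ψ`. -/
def genConst (ψ : ℝ → ℂ) : ℝ≥0∞ := (∑' j : {j : ℤ // j ≠ 0}, blockSup (fhat ψ) j) / delta ψ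

/-- Condition (A1). -/
def CondA1 (ψ : ℝ → ℂ) : Prop := MemLp ψ 2 volume ∧ PositiveDefinite ψ

/-- Condition (A2).  That `δ_ψ > 0` is part of `C_ψ < ∞`; it is written out because
`0 / 0 = 0` in `ℝ≥0∞`. -/
def CondA2 (ψ : ℝ → ℂ) : Prop :=
  amalgamNorm (fhat ψ) < ∞ ∧ 0 < delta ψ ∧ genConst ψ < ∞

/-! ### The operators on `L₂(𝕋)` -/

open Classical in
/-- Multiplication by `m` on `L₂(𝕋)` (value `0` where the product is not in `L₂(𝕋)`, which does not
happen for essentially bounded `m`). -/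
def mulOp (m : ℝ → ℂ) (g : L2T) : L2T :=
  if h : MemLp (fun ξ => m ξ * g ξ) 2 torus then h.toLp _ else 0

/-- `M_φ g = (δ_φ / φ̂) g`. -/
def opM (φ : ℝ → ℂ) (g : L2T) : L2T :=
  mulOp (fun ξ => ((delta φ).toReal : ℂ) / fhat φ ξ) g

/-- `T_{φ,k} g = δ_φ⁻¹ φ̂(· + 2πk) g`. -/
def opT (φ : ℝ → ℂ) (k : ℤ) (g : L2T) : L2T :=
  mulOp (fun ξ => ((delta φ).toReal : ℂ)⁻¹ * fhat φ (ξ + 2 * Real.pi * k)) g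

theorem memLp_exponential (x s : ℝ) :
    MemLp (fun t : ℝ => Complex.exp (-Complex.I * x * (t + s))) 2 torus := by
  refine MemLp.of_bound (C := 1) (by fun_prop) (Eventually.of_forall fun t => ?_)
  have h : -Complex.I * x * (t + s) = ((-(x * (t + s)) : ℝ) : ℂ) * Complex.I := by
    push_cast; ring
  rw [h, Complex.norm_exp_ofReal_mul_I]

/-- The exponential `t ↦ e^(-ix(t+s))` as an element of `L₂(𝕋)`. -/
def exponential (x s : ℝ) : L2T := (memLp_exponential x s).toLp _

open Classical in
/-- The prolongation operator `A_X^k` of a complete interpolating sequence `X = (x_j)`: if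
`h = ∑ c_j e^(-i x_j t)` in `L₂(𝕋)` with `c ∈ ℓ₂`, then
`A_X^k h = ∑ c_j e^(-i x_j (t + 2πk))`. -/
def prolongation (x : ℤ → ℝ) (k : ℤ) (h : L2T) : L2T :=
  if hc : ∃ c : ℤ → ℂ, Memℓp c 2 ∧ HasSum (fun j => c j • exponential (x j) 0) h then
    ∑' j : ℤ, hc.choose j • exponential (x j) (2 * Real.pi * k)
  else 0

/-- The sequence `ℤ`. -/
def intSeq : ℤ → ℝ := fun j => (j : ℝ)

/-- Conditions (B1)--(B4) on a family `(φ_α)_{α ∈ A}` relative to the generator `ψ`, the shift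
sequence `x` and the interpolation sequence `y`; `α → ∞` is the limit along `atTop`. -/
structure CondB {A : Type*} [Preorder A] (x y : ℤ → ℝ) (ψ : ℝ → ℂ) (φ : A → ℝ → ℂ) : Prop where
  b1 : ∀ α, CondA1 (φ α) ∧ CondA2 (φ α)
  b2 : ⨆ α, genConst (φ α) < ∞
  b3 : ∀ g : L2T, Tendsto
    (fun α => ∑' k : {k : ℤ // k ≠ 0},
      ‖opT ψ k (prolongation x k (opM ψ g - opM (φ α) g))‖ₑ) atTop (𝓝 0)
  b4 : ∀ g : L2T, Tendsto
    (fun α => ∑' k : {k : ℤ // k ≠ 0},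
      ‖opT (φ α) k (prolongation y k (opM (φ α) g)) -
        opT ψ k (prolongation x k (opM (φ α) g))‖ₑ) atTop (𝓝 0)

/-! ### Cardinal functions -/

/-- The symbol `∑_{j ∈ ℤ} φ̂(ξ + 2πj)`. -/
def symbol (φ : ℝ → ℂ) (ξ : ℝ) : ℂ := ∑' j : ℤ, fhat φ (ξ + 2 * Real.pi * j)

/-- The Fourier transform of the cardinal function,
`(2π)^(-1/2) φ̂(ξ) / ∑_j φ̂(ξ + 2πj)`. -/
def cardinalHat (φ : ℝ → ℂ) (ξ : ℝ) : ℂ :=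
  ((Real.sqrt (2 * Real.pi))⁻¹ : ℂ) * (fhat φ ξ / symbol φ ξ)

/-- The cardinal function `L_φ(x) = (2π)^(-1/2) ∫ L̂_φ(ξ) e^(iξx) dξ`. -/
def cardinalFunction (φ : ℝ → ℂ) (x : ℝ) : ℂ :=
  ((Real.sqrt (2 * Real.pi))⁻¹ : ℂ) * ∫ ξ : ℝ, cardinalHat φ ξ * Complex.exp (Complex.I * ξ * x)

/-- The defining formulas of `L_φ` make sense and `L_φ ∈ L₂(ℝ)`: the symbol converges absolutely and
does not vanish almost everywhere, and `L̂_φ` is integrable. -/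
structure CardinalWellDefined (φ : ℝ → ℂ) : Prop where
  symbol_summable : ∀ᵐ ξ : ℝ, Summable fun j : ℤ => fhat φ (ξ + 2 * Real.pi * j)
  symbol_ne_zero : ∀ᵐ ξ : ℝ, symbol φ ξ ≠ 0
  integrable_hat : Integrable (cardinalHat φ) volume
  memLp_two : MemLp (cardinalFunction φ) 2 volume

end

end CardinalInterpolation

namespace CardinalInterpolation

noncomputable section

/-! ### Periodization over the torus -/

/-! For integer nodes a shift by `2πk` does not change the exponentials, so every prolongation
operator is the identity (`prolongation_intSeq`). Test (B3) and (B4) on the constant `1`. The mixed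
term `T_ψ M_φ 1` cancels between them and so do the factors `δ`, leaving the ratio differences `φ̂(ξ
+ 2πk)/φ̂(ξ) - ψ̂(ξ + 2πk)/ψ̂(ξ)`; the sum over `k ≠ 0` of their `L₁(𝕋)` norms therefore tends to
`0` (`lintegral_ratio_sub_le`).

Positive definiteness makes the transforms nonnegative almost everywhere (`ae_fhat_nonneg`), so the
symbol is the `ℓ₁` norm of a fibre `ξ + 2πℤ` and no cancellation can occur in it. Passing from
division by the central value to division by the symbol then costs only a factor `2`
(`tsum_abs_div_tsum_sub_le`). Integrating over the torus gives convergence of `cardinalHat` in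
`L₁(ℝ)` (`lintegral_cardinalHat_sub_le`).

Uniform convergence follows by bounding the inverse Fourier integral by the `L₁` norm. For `L₂`, the
difference of two such transforms is at most `1` in modulus, so its squared `L₂` norm is at most its
`L₁` norm, and Plancherel finishes. -/

theorem ae_torus_shift {P : ℝ → Prop} (h : ∀ᵐ ξ : ℝ, P ξ) :
    ∀ᵐ ξ ∂torus, ∀ k : ℤ, P (ξ + 2 * Real.pi * k) := by
  rw [ae_all_iff]
  intro k
  exact ae_restrict_of_ae
    ((measurePreserving_add_right volume (2 * Real.pi * k)).quasiMeasurePreserving.ae h)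

theorem iUnion_shifted_torus :
    ⋃ k : ℤ, (fun ξ : ℝ => ξ - 2 * Real.pi * k) ⁻¹' Set.Ico (-Real.pi) Real.pi = Set.univ := by
  rw [← iUnion_Ico_add_zsmul Real.two_pi_pos (-Real.pi)]
  refine Set.iUnion_congr fun k => ?_
  ext ξ
  simp only [Set.mem_preimage, Set.mem_Ico, zsmul_eq_mul]
  push_cast
  constructor <;> rintro ⟨h1, h2⟩ <;> constructor <;> linarith

theorem lintegral_eq_tsum_torus (f : ℝ → ℝ≥0∞) :
    ∫⁻ ξ, f ξ = ∑' k : ℤ, ∫⁻ ξ, f (ξ + 2 * Real.pi * k) ∂torus := by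
  have hm : ∀ k : ℤ, MeasurableSet ((fun ξ : ℝ => ξ - 2 * Real.pi * k) ⁻¹'
      Set.Ico (-Real.pi) Real.pi) := fun k => measurableSet_Ico.preimage (by fun_prop)
  have hd : Pairwise (Function.onFun Disjoint fun k : ℤ =>
      (fun ξ : ℝ => ξ - 2 * Real.pi * k) ⁻¹' Set.Ico (-Real.pi) Real.pi) := by
    convert! Set.pairwise_disjoint_Ico_add_zsmul (-Real.pi) (2 * Real.pi) using 3 with k
    ext ξ
    simp only [Set.mem_preimage, Set.mem_Ico, zsmul_eq_mul]
    push_cast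
    constructor <;> rintro ⟨h1, h2⟩ <;> constructor <;> linarith
  rw [← setLIntegral_univ f, ← iUnion_shifted_torus, lintegral_iUnion hm hd]
  refine tsum_congr fun k => ?_
  have := (measurePreserving_add_right (volume : Measure ℝ)
    (2 * Real.pi * k)).setLIntegral_comp_preimage_emb
    (MeasurableEquiv.addRight (2 * Real.pi * k)).measurableEmbedding f
    ((fun ξ : ℝ => ξ - 2 * Real.pi * k) ⁻¹' Set.Ico (-Real.pi) Real.pi)
  rw [← this, ← Set.preimage_comp]
  have hid : (fun ξ : ℝ => ξ - 2 * Real.pi * k) ∘ (fun x => x + 2 * Real.pi * k) = id := by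
    ext; simp
  rw [hid, Set.preimage_id]

theorem ae_of_ae_torus {P : ℝ → Prop} (h : ∀ᵐ ξ ∂torus, ∀ k : ℤ, P (ξ + 2 * Real.pi * k)) :
    ∀ᵐ ξ : ℝ, P ξ := by
  rw [← Measure.restrict_univ (μ := (volume : Measure ℝ)), ← iUnion_shifted_torus,
    ae_restrict_iUnion_iff]
  intro k
  rw [ae_restrict_iff' measurableSet_Ico] at h
  rw [ae_restrict_iff' (measurableSet_Ico.preimage (by fun_prop))]
  filter_upwards [(measurePreserving_sub_right volume
    (2 * Real.pi * k)).quasiMeasurePreserving.ae h] with ξ hξ hmem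
  simpa using hξ hmem k

/-! ### The prolongation operators of the integer sequence -/

theorem exponential_intSeq (j k : ℤ) :
    exponential (intSeq j) (2 * Real.pi * k) = exponential (intSeq j) 0 := by
  unfold exponential
  congr 1
  funext t
  rw [Complex.exp_eq_exp_iff_exists_int]
  refine ⟨-(j * k), ?_⟩
  simp only [intSeq]
  push_cast
  ring

instance fact_two_pi_pos : Fact (0 < 2 * Real.pi) := ⟨Real.two_pi_pos⟩

theorem torus_eq_restrict_Ioc :
    torus = volume.restrict (Set.Ioc (-Real.pi) (-Real.pi + 2 * Real.pi)) := by
  have : -Real.pi + 2 * Real.pi = Real.pi := by ring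
  rw [this]
  exact Measure.restrict_congr_set Ico_ae_eq_Ioc

theorem measurePreserving_torus_mk :
    MeasurePreserving ((↑) : ℝ → AddCircle (2 * Real.pi)) torus := by
  rw [torus_eq_restrict_Ioc]
  exact AddCircle.measurePreserving_mk _ _

theorem exists_memLp_circle (h : L2T) : ∃ H : AddCircle (2 * Real.pi) → ℂ,
    MemLp H 2 AddCircle.haarAddCircle ∧ (fun t : ℝ => H t) =ᵐ[torus] h := by
  have hH : Measurable (AddCircle.liftIoc (2 * Real.pi) (-Real.pi) (h : ℝ → ℂ)) :=
    ((Lp.stronglyMeasurable h).measurable.comp measurable_subtype_coe).comp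
      (AddCircle.measurableEquivIoc (2 * Real.pi) (-Real.pi)).measurable
  have hae : (fun t : ℝ => AddCircle.liftIoc (2 * Real.pi) (-Real.pi) (h : ℝ → ℂ) t)
      =ᵐ[torus] h := by
    have hmem : ∀ᵐ t ∂torus, t ∈ Set.Ioc (-Real.pi) (-Real.pi + 2 * Real.pi) := by
      rw [torus_eq_restrict_Ioc]
      exact ae_restrict_mem measurableSet_Ioc
    filter_upwards [hmem] with t ht
    exact AddCircle.liftIoc_coe_apply ht
  refine ⟨_, ?_, hae⟩
  rw [memLp_haarAddCircle_iff, ← measurePreserving_torus_mk.map_eq,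
    memLp_map_measure_iff hH.aestronglyMeasurable
      measurePreserving_torus_mk.measurable.aemeasurable]
  exact (Lp.memLp h).ae_eq hae.symm

/-- Fourier series on `AddCircle (2π)`, pulled back to the interval. The circle carries normalized
Haar measure, so the pullback `Φ` is only bounded, with constant `√(2π)`. -/
theorem exists_hasSum_exponential (h : L2T) : ∃ c : ℤ → ℂ, Memℓp c 2 ∧
    HasSum (fun j => c j • exponential (intSeq j) 0) h := by
  obtain ⟨H, hH, hae⟩ := exists_memLp_circle h
  have hac : torus.map ((↑) : ℝ → AddCircle (2 * Real.pi)) =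
      ENNReal.ofReal (2 * Real.pi) • AddCircle.haarAddCircle :=
    measurePreserving_torus_mk.map_eq
  have hpull : ∀ f : Lp ℂ 2 (AddCircle.haarAddCircle (T := 2 * Real.pi)),
      MemLp (fun t : ℝ => f (t : AddCircle (2 * Real.pi))) 2 torus := fun f =>
    ((memLp_haarAddCircle_iff.1 (Lp.memLp f)).comp_measurePreserving measurePreserving_torus_mk)
  have hq : Measure.QuasiMeasurePreserving ((↑) : ℝ → AddCircle (2 * Real.pi)) torus
      AddCircle.haarAddCircle := by
    refine ⟨measurePreserving_torus_mk.measurable, ?_⟩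
    rw [hac]
    exact Measure.smul_absolutelyContinuous
  let Φ : Lp ℂ 2 (AddCircle.haarAddCircle (T := 2 * Real.pi)) →ₗ[ℂ] L2T :=
    { toFun := fun f => (hpull f).toLp _
      map_add' := fun f g => by
        rw [← MemLp.toLp_add]
        exact MemLp.toLp_congr _ _ (hq.ae (Lp.coeFn_add f g))
      map_smul' := fun c f => by
        rw [RingHom.id_apply, ← MemLp.toLp_const_smul]
        exact MemLp.toLp_congr _ _ (hq.ae (Lp.coeFn_smul c f)) }
  have hΦn : ∀ f, ‖Φ f‖ ≤ (ENNReal.ofReal (2 * Real.pi) ^ (1 / (2:ℝ))).toReal * ‖f‖ := by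
    intro f
    have h1 : eLpNorm (fun t : ℝ => f (t : AddCircle (2 * Real.pi))) 2 torus =
        ENNReal.ofReal (2 * Real.pi) ^ (1 / (2:ℝ)) *
          eLpNorm f 2 AddCircle.haarAddCircle := by
      have h2 := eLpNorm_map_measure (μ := torus) (p := 2)
        (f := ((↑) : ℝ → AddCircle (2 * Real.pi))) (g := f)
        (by rw [hac]; exact (Lp.aestronglyMeasurable f).smul_measure _)
        measurePreserving_torus_mk.measurable.aemeasurable
      rw [hac, eLpNorm_smul_measure_of_ne_top (by norm_num)] at h2
      rw [Function.comp_def] at h2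
      rw [← h2]
      simp
    change ‖(hpull f).toLp _‖ ≤ _
    rw [Lp.norm_toLp, h1, ENNReal.toReal_mul, Lp.norm_def]
  let Ψ := Φ.mkContinuous _ hΦn
  let F : Lp ℂ 2 (AddCircle.haarAddCircle (T := 2 * Real.pi)) := hH.toLp H
  have hΨF : Ψ F = h := by
    refine Lp.ext ?_
    have h1 : Ψ F =ᵐ[torus] fun t : ℝ => F (t : AddCircle (2 * Real.pi)) :=
      (hpull F).coeFn_toLp
    exact h1.trans (EventuallyEq.trans (hq.ae hH.coeFn_toLp) hae)
  -- The exponentials here carry a minus sign in the exponent, hence the reindexing by `j ↦ -j`.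
  have hΨe : ∀ j : ℤ, Ψ (fourierLp 2 j) = exponential (intSeq (-j)) 0 := by
    intro j
    refine Lp.ext ?_
    have h1 : Ψ (fourierLp 2 j) =ᵐ[torus]
        fun t : ℝ => fourierLp (T := 2 * Real.pi) 2 j (t : AddCircle (2 * Real.pi)) :=
      (hpull _).coeFn_toLp
    refine h1.trans (EventuallyEq.trans (hq.ae (coeFn_fourierLp 2 j)) ?_)
    refine EventuallyEq.trans ?_ (memLp_exponential (intSeq (-j)) 0).coeFn_toLp.symm
    refine Eventually.of_forall fun t => ?_
    simp only [fourier_coe_apply, intSeq]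
    congr 1
    have : (Real.pi : ℂ) ≠ 0 := by exact_mod_cast Real.pi_ne_zero
    push_cast
    field_simp
    ring
  have hs := (hasSum_fourier_series_L2 F).mapL Ψ
  simp only [map_smul, hΨe, hΨF] at hs
  refine ⟨fun j => fourierCoeff F (-j), ?_, ?_⟩
  · refine memℓp_gen ?_
    have := (hasSum_sq_fourierCoeff F).summable
    have := (Equiv.neg ℤ).summable_iff.2 this
    simpa [Function.comp_def] using this
  · have := (Equiv.neg ℤ).hasSum_iff.2 hs
    simpa [Function.comp_def] using this

/-- Whichever expansion `choose` picks, the shifted series is the same series and sums to `h`;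
uniqueness of coefficients is not needed. -/
theorem prolongation_intSeq (k : ℤ) (h : L2T) : prolongation intSeq k h = h := by
  have hc := exists_hasSum_exponential h
  rw [prolongation, dif_pos hc]
  simp_rw [exponential_intSeq]
  exact hc.choose_spec.2.tsum_eq

/-! ### Integrated positive definiteness -/

theorem PositiveDefinite.norm_le {ψ : ℝ → ℂ} (h : PositiveDefinite ψ) (x : ℝ) :
    ‖ψ x‖ ≤ (ψ 0).re := by
  have h2 : ∀ c : ℂ, 0 ≤ (ψ 0 + (starRingEnd ℂ c * ψ x + c * ψ (-x)) +
      c * starRingEnd ℂ c * ψ 0).re ∧ (ψ 0 + (starRingEnd ℂ c * ψ x + c * ψ (-x)) +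
      c * starRingEnd ℂ c * ψ 0).im = 0 := by
    intro c
    have := h 2 ![x, 0] ![1, c]
    simp only [Fin.sum_univ_two, Matrix.cons_val_zero, Matrix.cons_val_one, sub_self, sub_zero,
      zero_sub, map_one, one_mul, mul_one] at this
    convert this using 3 <;> ring
  have h0 : (ψ 0).im = 0 := by simpa using (h 1 ![0] ![1]).2
  have hneg : ψ (-x) = starRingEnd ℂ (ψ x) := by
    -- Reality of the form at `c = 1` and `c = i` determines the imaginary and real parts of `ψ
    -- (-x)`.
    have e1 := (h2 1).2
    have e2 := (h2 Complex.I).2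
    simp [h0] at e1 e2
    apply Complex.ext <;> simp <;> linarith
  rcases eq_or_ne (ψ x) 0 with hx | hx
  · have := (h 1 ![0] ![1]).1
    simpa [hx] using this
  · have hn : (‖ψ x‖ : ℂ) ≠ 0 := by simpa using hx
    -- This unimodular weight makes both cross terms equal to `-‖ψ x‖`.
    have e := (h2 (-(ψ x / ‖ψ x‖))).1
    have e1 : ψ x * starRingEnd ℂ (ψ x) = ‖ψ x‖ ^ 2 := by
      rw [Complex.mul_conj, Complex.normSq_eq_norm_sq]; push_cast; rfl
    have e2 : (ψ 0 + (starRingEnd ℂ (-(ψ x / ‖ψ x‖)) * ψ x + (-(ψ x / ‖ψ x‖)) * ψ (-x)) +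
        (-(ψ x / ‖ψ x‖)) * starRingEnd ℂ (-(ψ x / ‖ψ x‖)) * ψ 0) =
        2 * ψ 0 - 2 * (‖ψ x‖ : ℂ) := by
      rw [hneg]
      simp only [map_neg, map_div₀, Complex.conj_ofReal]
      field_simp
      linear_combination (-2 * (‖ψ x‖ : ℂ) + ψ 0) * e1
    rw [e2] at e
    simp at e
    exact e

/-- Sample `n` independent points from `μ`: the double sum has expectation `n D + n(n - 1) I`, with
`D` the diagonal integral and `I` the product integral. It is nonnegative for all `n`, and the
quadratic term dominates, so `I ≥ 0`. This replaces Riemann sums, which would require continuity of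
`f`. -/
theorem integral_prod_nonneg_of_forall_sum_nonneg {α : Type*} [MeasurableSpace α]
    (μ : Measure α) [IsProbabilityMeasure μ] (f : α × α → ℝ) (hf : Integrable f (μ.prod μ))
    (hd : Integrable (fun x => f (x, x)) μ)
    (hpos : ∀ (n : ℕ) (x : Fin n → α), 0 ≤ ∑ i, ∑ j, f (x i, x j)) :
    0 ≤ ∫ p, f p ∂(μ.prod μ) := by
  have hmap : ∀ (n : ℕ) (i j : Fin n), i ≠ j → MeasurePreserving
      (fun x : Fin n → α => (x i, x j)) (Measure.pi fun _ => μ) (μ.prod μ) := by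
    intro n i j hij
    refine ⟨by fun_prop, ?_⟩
    have hind := (ProbabilityTheory.iIndepFun_pi (μ := fun _ : Fin n => μ) (X := fun _ => id)
      fun _ => aemeasurable_id).indepFun hij
    simp only [id] at hind
    rw [ProbabilityTheory.indepFun_iff_map_prod_eq_prod_map_map
      (measurable_pi_apply i).aemeasurable (measurable_pi_apply j).aemeasurable] at hind
    rw [hind]
    congr 1
    · exact (measurePreserving_eval (fun _ : Fin n => μ) i).map_eq
    · exact (measurePreserving_eval (fun _ : Fin n => μ) j).map_eq
  set I := ∫ p, f p ∂(μ.prod μ) with hI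
  set D := ∫ x, f (x, x) ∂μ with hD
  have hint : ∀ (n : ℕ) (i j : Fin n), Integrable (fun x : Fin n → α => f (x i, x j))
      (Measure.pi fun _ => μ) ∧ ∫ x : Fin n → α, f (x i, x j) ∂(Measure.pi fun _ => μ) =
        if i = j then D else I := by
    intro n i j
    by_cases hij : i = j
    · subst hij
      have hm := measurePreserving_eval (fun _ : Fin n => μ) i
      rw [if_pos rfl]
      refine ⟨hm.integrable_comp_of_integrable hd, ?_⟩
      have := integral_map (f := fun x => f (x, x)) hm.measurable.aemeasurable
        (by rw [hm.map_eq]; exact hd.aestronglyMeasurable)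
      rw [hm.map_eq] at this
      exact this.symm
    · have hm := hmap n i j hij
      rw [if_neg hij]
      refine ⟨hm.integrable_comp_of_integrable hf, ?_⟩
      rw [hI, ← hm.map_eq, integral_map hm.measurable.aemeasurable
        (by rw [hm.map_eq]; exact hf.aestronglyMeasurable)]
  have key : ∀ n : ℕ, 0 ≤ (n : ℝ) * (D - I) + (n : ℝ) * n * I := by
    intro n
    have h1 : 0 ≤ ∫ x : Fin n → α, ∑ i, ∑ j, f (x i, x j) ∂(Measure.pi fun _ => μ) :=
      integral_nonneg fun x => hpos n x
    rw [integral_finsetSum _ fun i _ => integrable_finsetSum _ fun j _ => (hint n i j).1] at h1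
    simp_rw [integral_finsetSum _ fun j _ => (hint n _ j).1, (hint n _ _).2] at h1
    have h2 : ∀ i j : Fin n, (if i = j then D else I) = (if i = j then D - I else 0) + I := by
      intro i j; split_ifs <;> ring
    simp_rw [h2, Finset.sum_add_distrib, Finset.sum_ite_eq, Finset.mem_univ, if_true] at h1
    simp only [Finset.sum_const, Finset.card_univ, Fintype.card_fin, nsmul_eq_mul] at h1
    linarith
  by_contra hneg
  push Not at hneg
  obtain ⟨n, hn⟩ := exists_nat_gt ((D - I) / (-I))
  have hI' : 0 < -I := by linarith
  rw [div_lt_iff₀ hI'] at hn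
  have := key (n + 1)
  push_cast at this
  have hn0 : (0 : ℝ) < n + 1 := by positivity
  have : 0 ≤ (n + 1 : ℝ) * ((D - I) + (n + 1) * I) := by linarith
  have := nonneg_of_mul_nonneg_right this hn0
  linarith

-- Factor `g` as its modulus times its phase. The normalized modulus is the density of a probability
-- measure `μ`, and the phase scaled by `N` is a bounded weight `c`; the sampling lemma then applies
-- on `μ.prod μ`.
open ComplexOrder in
theorem PositiveDefinite.integral_prod_nonneg {ψ : ℝ → ℂ} (h : PositiveDefinite ψ)
    (hm : AEStronglyMeasurable ψ volume) {g : ℝ → ℂ} (hgm : Measurable g) (hg : Integrable g) :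
    0 ≤ ∫ p : ℝ × ℝ, g p.1 * starRingEnd ℂ (g p.2) * ψ (p.1 - p.2) := by
  set N : ℝ := ∫ x, ‖g x‖ with hN
  rcases (integral_nonneg fun x => norm_nonneg (g x) : 0 ≤ N).eq_or_lt with h0 | hNpos'
  · have hg0 : g =ᵐ[volume] 0 := by
      have := (integral_eq_zero_iff_of_nonneg (fun x => norm_nonneg (g x)) hg.norm).1 h0.symm
      filter_upwards [this] with x hx
      simpa using hx
    have : (fun p : ℝ × ℝ => g p.1 * starRingEnd ℂ (g p.2) * ψ (p.1 - p.2)) =ᵐ[volume] 0 := by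
      filter_upwards [Measure.quasiMeasurePreserving_fst.ae hg0] with p hp
      simp [hp]
    rw [integral_congr_ae this]
    simp
  have hNpos : 0 < N := hNpos'
  let w : ℝ → ℝ≥0∞ := fun x => ENNReal.ofReal (‖g x‖ / N)
  have hw : Measurable w := by fun_prop
  let μ : Measure ℝ := volume.withDensity w
  have hwt : ∀ x, (w x).toReal = ‖g x‖ / N := fun x => ENNReal.toReal_ofReal (by positivity)
  have hμ : IsProbabilityMeasure μ := by
    refine ⟨?_⟩
    rw [withDensity_apply _ MeasurableSet.univ, setLIntegral_univ,
      ← ofReal_integral_eq_lintegral_ofReal (hg.norm.div_const N)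
        (Eventually.of_forall fun x => by positivity), integral_div, ← hN, div_self hNpos.ne']
    simp
  have hac : μ ≪ volume := withDensity_absolutelyContinuous _ _
  let c : ℝ → ℂ := fun x => (N : ℂ) * (g x / ‖g x‖)
  have hc : Measurable c := by fun_prop
  have hcb : ∀ x, ‖c x‖ ≤ N := by
    intro x
    simp only [c, norm_mul, norm_div, Complex.norm_real, norm_norm, Real.norm_of_nonneg hNpos.le]
    exact mul_le_of_le_one_right hNpos.le (div_self_le_one _)
  have hwc : ∀ x, ((w x).toReal : ℂ) * c x = g x := by
    intro x
    rw [hwt]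
    by_cases hx : g x = 0
    · simp [hx, c]
    · have : (‖g x‖ : ℂ) ≠ 0 := by simpa using hx
      have : (N : ℂ) ≠ 0 := by exact_mod_cast hNpos.ne'
      simp only [c]
      push_cast
      field_simp
  let F : ℝ × ℝ → ℂ := fun p => c p.1 * starRingEnd ℂ (c p.2) * ψ (p.1 - p.2)
  have hψm : AEStronglyMeasurable (fun p : ℝ × ℝ => ψ (p.1 - p.2)) (volume.prod volume) :=
    hm.comp_quasiMeasurePreserving (quasiMeasurePreserving_sub_of_right_invariant _ _)
  have hFm : AEStronglyMeasurable F (μ.prod μ) := by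
    refine AEStronglyMeasurable.mul ?_ (hψm.mono_ac (hac.prod hac))
    have : Measurable fun p : ℝ × ℝ => c p.1 * starRingEnd ℂ (c p.2) :=
      (hc.comp measurable_fst).mul (Complex.continuous_conj.measurable.comp
        (hc.comp measurable_snd))
    exact this.aestronglyMeasurable
  have hFi : Integrable F (μ.prod μ) := by
    refine Integrable.of_bound hFm (N * N * (ψ 0).re) (Eventually.of_forall fun p => ?_)
    simp only [F, norm_mul, RCLike.norm_conj]
    gcongr
    exacts [hcb _, hcb _, h.norm_le _]
  have hdi : Integrable (fun x => F (x, x)) μ := by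
    refine Integrable.of_bound ?_ (N * N * (ψ 0).re) (Eventually.of_forall fun p => ?_)
    · simp only [F, sub_self]
      exact ((hc.mul (Complex.continuous_conj.measurable.comp hc)).mul_const _).aestronglyMeasurable
    · simp only [F, norm_mul, RCLike.norm_conj]
      gcongr
      exacts [hcb _, hcb _, h.norm_le _]
  have hpd : 0 ≤ ∫ p, F p ∂(μ.prod μ) := by
    rw [Complex.nonneg_iff]
    have hre := integral_prod_nonneg_of_forall_sum_nonneg μ (fun p => (F p).re) hFi.re hdi.re
      fun n x => by simpa [F] using (h n x (fun i => c (x i))).1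
    have him := integral_prod_nonneg_of_forall_sum_nonneg μ (fun p => (F p).im) hFi.im hdi.im
      fun n x => by simpa [F] using (h n x (fun i => c (x i))).2.ge
    -- The sampled sums are real, so both signs of the imaginary part are admissible and the
    -- integral is real.
    have him' := integral_prod_nonneg_of_forall_sum_nonneg μ (fun p => -(F p).im) hFi.im.neg
      hdi.im.neg fun n x => by
        simpa only [F, Complex.im_sum, Finset.sum_neg_distrib, neg_nonneg] using
          (h n x (fun i => c (x i))).2.le
    rw [integral_neg] at him'
    have e1 : (∫ p, F p ∂(μ.prod μ)).re = ∫ p, (F p).re ∂(μ.prod μ) := (integral_re hFi).symm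
    have e2 : (∫ p, F p ∂(μ.prod μ)).im = ∫ p, (F p).im ∂(μ.prod μ) := (integral_im hFi).symm
    rw [e1, e2]
    exact ⟨hre, by linarith⟩
  convert hpd using 1
  have hprod : μ.prod μ = (volume.prod volume).withDensity fun p => w p.1 * w p.2 :=
    prod_withDensity hw hw
  rw [hprod, integral_withDensity_eq_integral_toReal_smul (by fun_prop)
    (Eventually.of_forall fun p => ENNReal.mul_lt_top ENNReal.ofReal_lt_top ENNReal.ofReal_lt_top)]
  refine integral_congr_ae (Eventually.of_forall fun p => ?_)
  simp only [F, ENNReal.toReal_mul, Complex.real_smul]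
  conv_lhs => rw [← hwc p.1, ← hwc p.2]
  simp only [map_mul, Complex.conj_ofReal]
  push_cast
  ring

/-! ### Nonnegativity of the Fourier transform of a positive definite function -/

section Fourier

open FourierTransform SchwartzMap

theorem fourier_postcomp_conj (h : 𝓢(ℝ, ℂ)) (y : ℝ) :
    𝓕 (h.postcompCLM Complex.conjCLE.toContinuousLinearMap) y = starRingEnd ℂ (𝓕 h (-y)) := by
  rw [fourier_coe, fourier_coe, Real.fourier_real_eq_integral_exp_smul,
    Real.fourier_real_eq_integral_exp_smul, ← integral_conj]
  refine integral_congr_ae (Eventually.of_forall fun v => ?_)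
  simp only [postcompCLM_apply, smul_eq_mul, map_mul, ← Complex.exp_conj, Complex.conj_ofReal,
    Complex.conj_I]
  have : starRingEnd ℂ (h v) = Complex.conjCLE.toContinuousLinearMap (h v) := rfl
  rw [this]
  congr 2
  push_cast
  ring

/-- Fubini, then the substitution `x ↦ t - x` in the inner integral. Boundedness of `ψ` supplies
integrability. -/
theorem PositiveDefinite.integral_mul_convolution {ψ : ℝ → ℂ} (hψ : PositiveDefinite ψ)
    (hm : AEStronglyMeasurable ψ volume) {g k : ℝ → ℂ} (hg : Integrable g) (hk : Integrable k)
    (hgk : ∀ y, k y = starRingEnd ℂ (g (-y))) :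
    ∫ x, (∫ t, g t * k (x - t)) * ψ x =
      ∫ p : ℝ × ℝ, g p.1 * starRingEnd ℂ (g p.2) * ψ (p.1 - p.2) := by
  have hgc : Integrable fun y => starRingEnd ℂ (g y) := by
    refine hk.comp_neg.congr (Eventually.of_forall fun y => ?_)
    simp [hgk]
  have h1 : Integrable (fun p : ℝ × ℝ => g p.2 * k (p.1 - p.2) * ψ p.1)
      (volume.prod volume) := by
    refine Integrable.mul_bdd (c := (ψ 0).re)
      (hg.convolution_integrand (ContinuousLinearMap.mul ℂ ℂ) hk) ?_
      (Eventually.of_forall fun p => hψ.norm_le _)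
    exact hm.comp_quasiMeasurePreserving Measure.quasiMeasurePreserving_fst
  have h2 : Integrable (fun p : ℝ × ℝ => g p.1 * starRingEnd ℂ (g p.2) * ψ (p.1 - p.2))
      (volume.prod volume) :=
    Integrable.mul_bdd (c := (ψ 0).re) (hg.mul_prod hgc)
      (hm.comp_quasiMeasurePreserving (quasiMeasurePreserving_sub_of_right_invariant _ _))
      (Eventually.of_forall fun p => hψ.norm_le _)
  simp_rw [← integral_mul_const]
  rw [integral_integral_swap h1]
  change _ = ∫ p : ℝ × ℝ, _ ∂(volume.prod volume)
  rw [integral_prod _ h2]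
  refine integral_congr_ae (Eventually.of_forall fun t => ?_)
  dsimp only
  rw [← integral_sub_left_eq_self _ volume t]
  simp [hgk]

-- `|h|²` is the inverse transform of the convolution `v` of `𝓕 h` with `𝓕 hb`. Duality for tempered
-- distributions moves that inverse transform onto `𝓕 ψ`, and what remains is the integrated
-- positive definite form with `g = 𝓕 h`.
open ComplexOrder in
theorem PositiveDefinite.integral_fourier_nonneg {ψ : ℝ → ℂ} (hψ : PositiveDefinite ψ)
    (hL : MemLp ψ 2 volume) (h : 𝓢(ℝ, ℂ)) :
    0 ≤ ∫ ξ, h ξ * starRingEnd ℂ (h ξ) * (𝓕 (hL.toLp ψ) : Lp ℂ 2 (volume : Measure ℝ)) ξ := by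
  set F : Lp ℂ 2 (volume : Measure ℝ) := 𝓕 (hL.toLp ψ)
  let hb : 𝓢(ℝ, ℂ) := h.postcompCLM Complex.conjCLE.toContinuousLinearMap
  let v : 𝓢(ℝ, ℂ) := convolution (ContinuousLinearMap.mul ℂ ℂ) (𝓕 h) (𝓕 hb)
  have h1 : 𝓕⁻ (F : 𝓢'(ℝ, ℂ)) = ((hL.toLp ψ : Lp ℂ 2 (volume : Measure ℝ)) : 𝓢'(ℝ, ℂ)) := by
    rw [Lp.fourierInv_toTemperedDistribution_eq, fourierInv_fourier_eq]
  have h2 : ∫ x, 𝓕⁻ v x * F x = ∫ x, v x * ψ x := by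
    have := congrArg (fun T : 𝓢'(ℝ, ℂ) => T v) h1
    simp only [TemperedDistribution.fourierInv_apply, Lp.toTemperedDistribution_apply,
      smul_eq_mul] at this
    rw [this]
    refine integral_congr_ae ?_
    filter_upwards [hL.coeFn_toLp] with x hx
    rw [hx]
  have h3 : ∀ ξ, 𝓕⁻ v ξ = h ξ * starRingEnd ℂ (h ξ) := by
    intro ξ
    have h4 : 𝓕⁻ v ξ = 𝓕 v (-ξ) := by
      rw [fourierInv_coe, fourier_coe, Real.fourierInv_eq_fourier_neg]
    have h5 : ∀ w : 𝓢(ℝ, ℂ), 𝓕 (𝓕 w) (-ξ) = w ξ := by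
      intro w
      have : 𝓕⁻ (𝓕 w) ξ = 𝓕 (𝓕 w) (-ξ) := by
        rw [fourierInv_coe, fourier_coe (𝓕 w), Real.fourierInv_eq_fourier_neg]
      rw [← this, fourierInv_fourier_eq]
    rw [h4, fourier_convolution, pairing_apply_apply, h5, h5]
    simp [hb]
  simp_rw [← h3]
  rw [h2]
  have h6 : ∀ x, v x = ∫ t, 𝓕 h t * 𝓕 hb (x - t) := by
    intro x
    rw [convolution_apply]
    rfl
  simp_rw [h6]
  rw [hψ.integral_mul_convolution hL.1 (𝓕 h).integrable (𝓕 hb).integrable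
    (fourier_postcomp_conj h)]
  exact hψ.integral_prod_nonneg hL.1 (𝓕 h).continuous.measurable (𝓕 h).integrable

-- As `F` is bounded, `f ↦ ⟨f, F f⟩` is continuous on `L₂`, so nonnegativity passes from the dense
-- Schwartz functions to indicators of sets of finite measure, whose values are the integrals of `F`
-- over these sets.
open ComplexOrder in
theorem ae_nonneg_of_forall_schwartz {F : Lp ℂ 2 (volume : Measure ℝ)} {M : ℝ}
    (hM : ∀ᵐ ξ, ‖F ξ‖ ≤ M)
    (hF : ∀ h : 𝓢(ℝ, ℂ), 0 ≤ ∫ ξ, h ξ * starRingEnd ℂ (h ξ) * F ξ) :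
    ∀ᵐ ξ, 0 ≤ F ξ := by
  have hFtop : MemLp F ∞ volume := memLp_top_of_bound (Lp.aestronglyMeasurable F) M hM
  let Q := ContinuousLinearMap.holderL volume ∞ 2 2 (ContinuousLinearMap.mul ℂ ℂ) (hFtop.toLp F)
  have hQ : ∀ f : Lp ℂ 2 (volume : Measure ℝ), inner ℂ f (Q f) =
      ∫ ξ, f ξ * starRingEnd ℂ (f ξ) * F ξ := by
    intro f
    rw [L2.inner_def]
    refine integral_congr_ae ?_
    have h1 : Q f =ᵐ[volume] fun ξ => hFtop.toLp F ξ * f ξ :=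
      ContinuousLinearMap.coeFn_holder _ _ _
    filter_upwards [h1, hFtop.coeFn_toLp] with ξ h1 h2
    rw [h1, h2, RCLike.inner_apply]
    ring
  have hpos : ∀ f : Lp ℂ 2 (volume : Measure ℝ), 0 ≤ inner ℂ f (Q f) := by
    intro f
    refine DenseRange.induction_on (p := fun f => 0 ≤ inner ℂ f (Q f))
      (SchwartzMap.denseRange_toLpCLM (μ := (volume : Measure ℝ)) (p := 2)
        ENNReal.ofNat_ne_top) f ?_ ?_
    · exact isClosed_Ici.preimage (by fun_prop : Continuous fun f => inner ℂ f (Q f))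
    · intro h
      rw [hQ, toLpCLM_apply]
      convert hF h using 1
      refine integral_congr_ae ?_
      filter_upwards [h.coeFn_toLp 2 volume] with ξ hξ
      rw [hξ]
  have hset : ∀ s : Set ℝ, MeasurableSet s → volume s < ∞ → IntegrableOn F s ∧
      0 ≤ ∫ ξ in s, F ξ := by
    intro s hs hsf
    have : IsFiniteMeasure (volume.restrict s) := ⟨by simpa using hsf⟩
    have hi : IntegrableOn F s :=
      ((Lp.memLp F).restrict s).integrable (by norm_num)
    refine ⟨hi, ?_⟩
    have h1 := hpos (indicatorConstLp 2 hs hsf.ne (1 : ℂ))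
    rw [hQ] at h1
    convert h1 using 1
    rw [← integral_indicator hs]
    refine integral_congr_ae ?_
    filter_upwards [indicatorConstLp_coeFn (p := 2) (hs := hs) (hμs := hsf.ne) (c := (1 : ℂ))]
      with ξ hξ
    rw [hξ]
    by_cases hm : ξ ∈ s <;> simp [hm]
  have hre : 0 ≤ᵐ[volume] fun ξ => (F ξ).re := by
    refine ae_nonneg_of_forall_setIntegral_nonneg_of_sigmaFinite
      (fun s hs hsf => (hset s hs hsf).1.re) fun s hs hsf => ?_
    rw [show ∫ ξ in s, (F ξ).re = (∫ ξ in s, F ξ).re from integral_re (hset s hs hsf).1]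
    exact (Complex.nonneg_iff.1 (hset s hs hsf).2).1
  have him' : ∀ s : Set ℝ, MeasurableSet s → volume s < ∞ → ∫ ξ in s, (F ξ).im = 0 := by
    intro s hs hsf
    rw [show ∫ ξ in s, (F ξ).im = (∫ ξ in s, F ξ).im from integral_im (hset s hs hsf).1]
    exact (Complex.nonneg_iff.1 (hset s hs hsf).2).2.symm
  have him : 0 ≤ᵐ[volume] fun ξ => (F ξ).im :=
    ae_nonneg_of_forall_setIntegral_nonneg_of_sigmaFinite
      (fun s hs hsf => (hset s hs hsf).1.im) fun s hs hsf => (him' s hs hsf).ge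
  have him2 : 0 ≤ᵐ[volume] fun ξ => -(F ξ).im :=
    ae_nonneg_of_forall_setIntegral_nonneg_of_sigmaFinite
      (fun s hs hsf => (hset s hs hsf).1.im.neg) fun s hs hsf => by
        rw [integral_neg, him' s hs hsf, neg_zero]
  filter_upwards [hre, him, him2] with ξ h1 h2 h3
  rw [Complex.nonneg_iff]
  simp only [Pi.zero_apply] at h1 h2 h3
  exact ⟨h1, by linarith⟩

/-! ### Plancherel for integrable functions -/

theorem integral_fourierInv_mul_eq {f u : ℝ → ℂ} (hf : Integrable f) (hu : Integrable u) :
    ∫ x, 𝓕⁻ f x * u x = ∫ x, f x * 𝓕⁻ u x := by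
  have := VectorFourier.integral_fourierIntegral_smul_eq_flip (L := -innerₗ ℝ) (f := f) (g := u)
    (μ := volume) (ν := volume) Real.continuous_fourierChar
    (continuous_inner (𝕜 := ℝ) (E := ℝ)).neg hf hu
  have hflip : (-innerₗ ℝ : ℝ →ₗ[ℝ] ℝ →ₗ[ℝ] ℝ).flip = -innerₗ ℝ := by
    ext; simp
  rw [hflip] at this
  exact this

/-- Both sides have the same integral against every smooth compactly supported function: the left
through the distributional definition, the right through the multiplication formula. -/
theorem fourierInv_toLp_ae_eq {f : ℝ → ℂ} (hf : Integrable f) (hf2 : MemLp f 2 volume) :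
    (𝓕⁻ (hf2.toLp f) : Lp ℂ 2 (volume : Measure ℝ)) =ᵐ[volume] 𝓕⁻ f := by
  have hcont : Continuous (𝓕⁻ f) :=
    VectorFourier.fourierIntegral_continuous Real.continuous_fourierChar
      (continuous_inner (𝕜 := ℝ) (E := ℝ)).neg hf
  refine ae_eq_of_integral_contDiff_smul_eq
    ((Lp.memLp _).locallyIntegrable (by norm_num)) hcont.locallyIntegrable ?_
  intro g hg hgs
  let u : 𝓢(ℝ, ℂ) := HasCompactSupport.toSchwartzMap (f := fun x => (g x : ℂ))
    (hgs.comp_left Complex.ofReal_zero) (Complex.ofRealCLM.contDiff.comp hg)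
  have h1 := congrArg (fun T : 𝓢'(ℝ, ℂ) => T u)
    (Lp.fourierInv_toTemperedDistribution_eq (hf2.toLp f))
  simp only [TemperedDistribution.fourierInv_apply, Lp.toTemperedDistribution_apply,
    smul_eq_mul] at h1
  have h2 : ∫ x, 𝓕⁻ u x * hf2.toLp f x = ∫ x, f x * 𝓕⁻ (u : ℝ → ℂ) x := by
    refine integral_congr_ae ?_
    filter_upwards [hf2.coeFn_toLp] with x hx
    rw [hx, mul_comm, fourierInv_coe]
  rw [h2, ← integral_fourierInv_mul_eq hf u.integrable] at h1
  have h3 : ∀ x, (u x : ℂ) = (g x : ℂ) := fun x => rfl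
  simp_rw [h3] at h1
  simp_rw [Complex.real_smul]
  rw [← h1]
  simp_rw [mul_comm]

theorem eLpNorm_fourierInv {f : ℝ → ℂ} (hf : Integrable f) (hf2 : MemLp f 2 volume) :
    eLpNorm (𝓕⁻ f) 2 volume = eLpNorm f 2 volume := by
  rw [← eLpNorm_congr_ae (fourierInv_toLp_ae_eq hf hf2), ← eLpNorm_congr_ae hf2.coeFn_toLp,
    ← Lp.enorm_def, ← Lp.enorm_def, ← ofReal_norm, ← ofReal_norm]
  congr 1
  exact (Lp.fourierTransformₗᵢ ℝ ℂ).symm.norm_map _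

theorem aestronglyMeasurable_fourierInv {f : ℝ → ℂ} (hf : Integrable f) :
    AEStronglyMeasurable (𝓕⁻ f) volume :=
  (VectorFourier.fourierIntegral_continuous Real.continuous_fourierChar
      (continuous_inner (𝕜 := ℝ) (E := ℝ)).neg hf : Continuous (𝓕⁻ f)).aestronglyMeasurable

end Fourier

/-! ### Generators on almost every fibre of the periodization -/

theorem measurable_fhat (φ : ℝ → ℂ) : Measurable (fhat φ) := by
  unfold fhat
  split_ifs with h
  · exact ((Lp.stronglyMeasurable _).measurable.comp (by fun_prop)).const_mul _
  · exact measurable_const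

theorem ae_enorm_fhat_le_blockSup (φ : ℝ → ℂ) :
    ∀ᵐ ξ ∂torus, ∀ k : ℤ, ‖fhat φ (ξ + 2 * Real.pi * k)‖ₑ ≤ blockSup (fhat φ) k := by
  rw [ae_all_iff]
  intro k
  rw [blockSup, eLpNorm_exponent_top]
  exact enorm_ae_le_eLpNormEssSup _ _

theorem quasiMeasurePreserving_mul_const {a : ℝ} (ha : a ≠ 0) :
    Measure.QuasiMeasurePreserving (fun x : ℝ => x * a) volume volume := by
  refine ⟨by fun_prop, ?_⟩
  rw [Real.map_volume_mul_right ha]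
  exact Measure.smul_absolutelyContinuous

theorem sqrt_two_pi_pos : 0 < Real.sqrt (2 * Real.pi) := Real.sqrt_pos.2 Real.two_pi_pos

-- The amalgam norm supplies the essential bound on `F` that the density argument requires; the rest
-- undoes the rescaling by `2π`.
open ComplexOrder in
theorem ae_fhat_nonneg {φ : ℝ → ℂ} (h1 : CondA1 φ) (h2 : CondA2 φ) :
    ∀ᵐ ξ : ℝ, 0 ≤ fhat φ ξ := by
  obtain ⟨hL, hpd⟩ := h1
  set F : Lp ℂ 2 (volume : Measure ℝ) := FourierTransform.fourier (hL.toLp φ) with hF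
  have hfhat : ∀ ξ, fhat φ ξ = ((Real.sqrt (2 * Real.pi))⁻¹ : ℂ) * F (ξ / (2 * Real.pi)) := by
    intro ξ
    rw [fhat, dif_pos hL]
  have hb : ∀ᵐ ξ, ‖fhat φ ξ‖ₑ ≤ amalgamNorm (fhat φ) := by
    refine ae_of_ae_torus ?_
    filter_upwards [ae_enorm_fhat_le_blockSup φ] with ξ hξ k
    exact (hξ k).trans (ENNReal.le_tsum k)
  have hFb : ∀ᵐ η, ‖F η‖ ≤ Real.sqrt (2 * Real.pi) * (amalgamNorm (fhat φ)).toReal := by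
    filter_upwards [(quasiMeasurePreserving_mul_const Real.two_pi_pos.ne').ae hb] with η hη
    have h3 : ‖fhat φ (η * (2 * Real.pi))‖ ≤ (amalgamNorm (fhat φ)).toReal := by
      rw [← toReal_enorm]
      exact ENNReal.toReal_mono h2.1.ne hη
    rw [hfhat, mul_div_cancel_right₀ _ Real.two_pi_pos.ne', norm_mul, norm_inv,
      Complex.norm_real, Real.norm_of_nonneg sqrt_two_pi_pos.le,
      inv_mul_le_iff₀ sqrt_two_pi_pos] at h3
    exact h3
  have hFpos := ae_nonneg_of_forall_schwartz hFb fun h => hpd.integral_fourier_nonneg hL h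
  filter_upwards [(quasiMeasurePreserving_mul_const
    (inv_ne_zero Real.two_pi_pos.ne')).ae hFpos] with ξ hξ
  rw [hfhat, div_eq_mul_inv]
  refine mul_nonneg ?_ hξ
  rw [← Complex.ofReal_inv]
  exact Complex.zero_le_real.2 (inv_nonneg.2 sqrt_two_pi_pos.le)

/-- Needed because the operators use `(delta φ).toReal`, which would be `0` at `∞`. -/
theorem delta_ne_top {φ : ℝ → ℂ} (h : CondA2 φ) : delta φ ≠ ∞ := by
  have hne : NeZero torus := ⟨by simp [Measure.restrict_eq_zero, Real.pi_pos]⟩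
  have h1 : ∀ᵐ ξ ∂torus, delta φ ≤ ‖fhat φ ξ‖ₑ := ae_essInf_le
  obtain ⟨ξ, h2, h3⟩ := (h1.and (ae_enorm_fhat_le_blockSup φ)).exists
  have h4 := h3 0
  simp only [Int.cast_zero, mul_zero, add_zero] at h4
  exact ((h2.trans h4).trans (ENNReal.le_tsum (f := blockSup (fhat φ)) 0)).trans_lt h.1 |>.ne

/-- The values of a generator on the fibre `ξ + 2πℤ`: nonnegative, summable, and bounded as the
amalgam norm predicts. -/
structure IsRegularAt (φ : ℝ → ℂ) (ξ : ℝ) : Prop where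
  eq_norm : ∀ k : ℤ, fhat φ (ξ + 2 * Real.pi * k) = (‖fhat φ (ξ + 2 * Real.pi * k)‖ : ℂ)
  summable : Summable fun k : ℤ => ‖fhat φ (ξ + 2 * Real.pi * k)‖
  le_blockSup : ∀ k : ℤ, ‖fhat φ (ξ + 2 * Real.pi * k)‖ₑ ≤ blockSup (fhat φ) k
  delta_le : (delta φ).toReal ≤ ‖fhat φ ξ‖
  pos : 0 < ‖fhat φ ξ‖

theorem ae_isRegularAt {φ : ℝ → ℂ} (h1 : CondA1 φ) (h2 : CondA2 φ) :
    ∀ᵐ ξ ∂torus, IsRegularAt φ ξ := by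
  have hd : ∀ᵐ ξ ∂torus, delta φ ≤ ‖fhat φ ξ‖ₑ := ae_essInf_le
  filter_upwards [hd, ae_enorm_fhat_le_blockSup φ, ae_torus_shift (ae_fhat_nonneg h1 h2)]
    with ξ h3 h4 h5
  have h6 : (delta φ).toReal ≤ ‖fhat φ ξ‖ := by
    rw [← toReal_enorm]
    exact ENNReal.toReal_mono enorm_ne_top h3
  refine ⟨fun k => ?_, ?_, h4, h6, (ENNReal.toReal_pos h2.2.1.ne' (delta_ne_top h2)).trans_le h6⟩
  · exact (RCLike.norm_of_nonneg' (h5 k)).symm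
  · have h7 : ∑' k : ℤ, ‖fhat φ (ξ + 2 * Real.pi * k)‖ₑ ≠ ∞ :=
      ((ENNReal.tsum_le_tsum h4).trans_lt h2.1).ne
    simpa using ENNReal.summable_toReal h7

theorem symbol_add (φ : ℝ → ℂ) (ξ : ℝ) (k : ℤ) :
    symbol φ (ξ + 2 * Real.pi * k) = symbol φ ξ := by
  unfold symbol
  rw [← (Equiv.addLeft k).tsum_eq fun j : ℤ => fhat φ (ξ + 2 * Real.pi * j)]
  refine tsum_congr fun j => ?_
  congr 1
  simp only [Equiv.coe_addLeft]
  push_cast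
  ring

namespace IsRegularAt

variable {φ : ℝ → ℂ} {ξ : ℝ} (h : IsRegularAt φ ξ)
include h

theorem symbol_eq (k : ℤ) : symbol φ (ξ + 2 * Real.pi * k) =
    ((∑' j : ℤ, ‖fhat φ (ξ + 2 * Real.pi * j)‖ : ℝ) : ℂ) := by
  rw [symbol_add, symbol, Complex.ofReal_tsum]
  exact tsum_congr h.eq_norm

theorem le_tsum (k : ℤ) : ‖fhat φ (ξ + 2 * Real.pi * k)‖ ≤
    ∑' j : ℤ, ‖fhat φ (ξ + 2 * Real.pi * j)‖ :=
  h.summable.le_tsum k fun _ _ => norm_nonneg _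

theorem tsum_pos : 0 < ∑' j : ℤ, ‖fhat φ (ξ + 2 * Real.pi * j)‖ := by
  have := h.le_tsum 0
  simp only [Int.cast_zero, mul_zero, add_zero] at this
  exact h.pos.trans_le this

theorem cardinalHat_eq (k : ℤ) : cardinalHat φ (ξ + 2 * Real.pi * k) =
    (((Real.sqrt (2 * Real.pi))⁻¹ * (‖fhat φ (ξ + 2 * Real.pi * k)‖ /
      ∑' j : ℤ, ‖fhat φ (ξ + 2 * Real.pi * j)‖) : ℝ) : ℂ) := by
  rw [cardinalHat, h.symbol_eq, h.eq_norm k]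
  push_cast
  simp

end IsRegularAt

/-- Almost everywhere the symbol is the sum of the norms, which is measurable as a series in `ℝ≥0∞`.
-/
theorem aemeasurable_symbol {φ : ℝ → ℂ} (h1 : CondA1 φ) (h2 : CondA2 φ) :
    AEMeasurable (symbol φ) volume := by
  have hm : Measurable fun ξ => ∑' j : ℤ, ‖fhat φ (ξ + 2 * Real.pi * j)‖ₑ :=
    Measurable.tsum fun j => ((measurable_fhat φ).comp (by fun_prop)).enorm
  refine ⟨fun ξ => ((∑' j : ℤ, ‖fhat φ (ξ + 2 * Real.pi * j)‖ₑ).toReal : ℂ),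
    Complex.measurable_ofReal.comp hm.ennreal_toReal, ?_⟩
  refine ae_of_ae_torus ?_
  filter_upwards [ae_isRegularAt h1 h2] with ξ hξ k
  rw [hξ.symbol_eq, ENNReal.tsum_toReal_eq fun _ => enorm_ne_top]
  congr 1
  rw [← (Equiv.addLeft k).tsum_eq]
  refine tsum_congr fun j => ?_
  rw [toReal_enorm]
  congr 2
  simp only [Equiv.coe_addLeft]
  push_cast
  ring

theorem aestronglyMeasurable_cardinalHat {φ : ℝ → ℂ} (h1 : CondA1 φ) (h2 : CondA2 φ) :
    AEStronglyMeasurable (cardinalHat φ) volume :=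
  (((measurable_fhat φ).aemeasurable.div (aemeasurable_symbol h1 h2)).const_mul
    _).aestronglyMeasurable

/-- The quotient is at most `1` and `1/√(2π) ≤ 1/2`. The value `1/2` is chosen so that a difference
of two such transforms is at most `1`. -/
theorem ae_norm_cardinalHat_le {φ : ℝ → ℂ} (h1 : CondA1 φ) (h2 : CondA2 φ) :
    ∀ᵐ ξ, ‖cardinalHat φ ξ‖ ≤ 1 / 2 := by
  refine ae_of_ae_torus ?_
  filter_upwards [ae_isRegularAt h1 h2] with ξ hξ k
  rw [hξ.cardinalHat_eq, Complex.norm_real, Real.norm_of_nonneg (mul_nonneg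
    (inv_nonneg.2 sqrt_two_pi_pos.le) (div_nonneg (norm_nonneg _) hξ.tsum_pos.le))]
  have h3 : (Real.sqrt (2 * Real.pi))⁻¹ ≤ 1 / 2 := by
    rw [one_div]
    refine inv_anti₀ two_pos (Real.le_sqrt_of_sq_le ?_)
    nlinarith [Real.pi_gt_three]
  calc _ ≤ (1 / 2 : ℝ) * 1 := by
        gcongr
        exact div_le_one_of_le₀ (hξ.le_tsum k) hξ.tsum_pos.le
    _ = 1 / 2 := mul_one _

theorem lintegral_enorm_eq_lintegral_tsum {f : ℝ → ℂ} (hf : AEStronglyMeasurable f volume) :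
    ∫⁻ ξ, ‖f ξ‖ₑ = ∫⁻ ξ, ∑' k : ℤ, ‖f (ξ + 2 * Real.pi * k)‖ₑ ∂torus := by
  rw [lintegral_eq_tsum_torus, lintegral_tsum]
  intro k
  exact (hf.comp_measurePreserving
    (measurePreserving_add_right volume (2 * Real.pi * k))).restrict.enorm

theorem integrable_cardinalHat {φ : ℝ → ℂ} (h1 : CondA1 φ) (h2 : CondA2 φ) :
    Integrable (cardinalHat φ) volume := by
  refine ⟨aestronglyMeasurable_cardinalHat h1 h2, ?_⟩
  rw [HasFiniteIntegral, lintegral_enorm_eq_lintegral_tsum (aestronglyMeasurable_cardinalHat h1 h2)]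
  -- On each fibre the quotients sum to exactly `1`.
  calc _ ≤ ∫⁻ _, ENNReal.ofReal (Real.sqrt (2 * Real.pi))⁻¹ ∂torus := by
        refine lintegral_mono_ae ?_
        filter_upwards [ae_isRegularAt h1 h2] with ξ hξ
        have h3 : ∀ k : ℤ, ‖cardinalHat φ (ξ + 2 * Real.pi * k)‖ₑ =
            ENNReal.ofReal ((Real.sqrt (2 * Real.pi))⁻¹ * (‖fhat φ (ξ + 2 * Real.pi * k)‖ /
              ∑' j : ℤ, ‖fhat φ (ξ + 2 * Real.pi * j)‖)) := by
          intro k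
          rw [hξ.cardinalHat_eq, ← ofReal_norm, Complex.norm_real, Real.norm_of_nonneg (mul_nonneg
            (inv_nonneg.2 sqrt_two_pi_pos.le) (div_nonneg (norm_nonneg _) hξ.tsum_pos.le))]
        simp_rw [h3]
        rw [← ENNReal.ofReal_tsum_of_nonneg (fun k => mul_nonneg
            (inv_nonneg.2 sqrt_two_pi_pos.le) (div_nonneg (norm_nonneg _) hξ.tsum_pos.le))
          ((hξ.summable.div_const _).mul_left _), tsum_mul_left, tsum_div_const,
          div_self hξ.tsum_pos.ne', mul_one]
    _ < ∞ := by simp [ENNReal.mul_lt_top_iff]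

theorem eLpNorm_two_le_of_norm_le_one {f : ℝ → ℂ} (hf : ∀ᵐ ξ, ‖f ξ‖ ≤ 1) :
    eLpNorm f 2 volume ≤ (∫⁻ ξ, ‖f ξ‖ₑ) ^ (1 / 2 : ℝ) := by
  rw [eLpNorm_eq_lintegral_rpow_enorm_toReal (by norm_num) (by norm_num), ENNReal.toReal_ofNat]
  gcongr 1
  refine lintegral_mono_ae ?_
  filter_upwards [hf] with ξ hξ
  have h1 : ‖f ξ‖ₑ ≤ 1 := by
    rw [← ofReal_norm]
    exact ENNReal.ofReal_le_one.2 hξ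
  exact ENNReal.rpow_le_self_of_le_one h1 (by norm_num)

theorem memLp_cardinalHat {φ : ℝ → ℂ} (h1 : CondA1 φ) (h2 : CondA2 φ) :
    MemLp (cardinalHat φ) 2 volume :=
  ⟨aestronglyMeasurable_cardinalHat h1 h2, (eLpNorm_two_le_of_norm_le_one
    ((ae_norm_cardinalHat_le h1 h2).mono fun _ h => h.trans (by norm_num))).trans_lt
    (ENNReal.rpow_lt_top_of_nonneg (by norm_num) (integrable_cardinalHat h1 h2).2.ne)⟩

/-! ### The inverse Fourier integral -/

/-- The inverse Fourier integral `x ↦ (2π)^(-1/2) ∫ f(ξ) e^(iξx) dξ`. -/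
def fourierSynthesis (f : ℝ → ℂ) (x : ℝ) : ℂ :=
  ((Real.sqrt (2 * Real.pi))⁻¹ : ℂ) * ∫ ξ : ℝ, f ξ * Complex.exp (Complex.I * ξ * x)

theorem fourierSynthesis_eq (f : ℝ → ℂ) (x : ℝ) : fourierSynthesis f x =
    ((Real.sqrt (2 * Real.pi))⁻¹ : ℂ) *
      FourierTransformInv.fourierInv f (x * (2 * Real.pi)⁻¹) := by
  rw [fourierSynthesis, Real.fourierInv_eq']
  congr 1
  refine integral_congr_ae (Eventually.of_forall fun ξ => ?_)
  simp only [RCLike.inner_apply, conj_trivial, smul_eq_mul]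
  rw [mul_comm]
  congr 2
  have : (Real.pi : ℂ) ≠ 0 := by exact_mod_cast Real.pi_ne_zero
  push_cast
  field_simp

theorem integrable_mul_exp {f : ℝ → ℂ} (hf : Integrable f) (x : ℝ) :
    Integrable fun ξ : ℝ => f ξ * Complex.exp (Complex.I * ξ * x) := by
  refine hf.mul_bdd (c := 1) (by fun_prop) (Eventually.of_forall fun ξ => ?_)
  have h : Complex.I * ξ * x = ((ξ * x : ℝ) : ℂ) * Complex.I := by push_cast; ring
  rw [h, Complex.norm_exp_ofReal_mul_I]

theorem fourierSynthesis_sub {f g : ℝ → ℂ} (hf : Integrable f) (hg : Integrable g) (x : ℝ) :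
    fourierSynthesis f x - fourierSynthesis g x = fourierSynthesis (fun ξ => f ξ - g ξ) x := by
  simp only [fourierSynthesis, sub_mul]
  rw [integral_sub (integrable_mul_exp hf x) (integrable_mul_exp hg x), mul_sub]

theorem enorm_fourierSynthesis_le (f : ℝ → ℂ) (x : ℝ) :
    ‖fourierSynthesis f x‖ₑ ≤ ‖((Real.sqrt (2 * Real.pi))⁻¹ : ℂ)‖ₑ * ∫⁻ ξ, ‖f ξ‖ₑ := by
  rw [fourierSynthesis, enorm_mul]
  gcongr
  refine (enorm_integral_le_lintegral_enorm _).trans (lintegral_mono fun ξ => ?_)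
  have h : Complex.I * ξ * x = ((ξ * x : ℝ) : ℂ) * Complex.I := by push_cast; ring
  rw [enorm_mul, h, ← ofReal_norm (Complex.exp _), Complex.norm_exp_ofReal_mul_I]
  simp

/-- Plancherel after the dilation `x ↦ x/(2π)`. The two normalizing factors in `K` are inverse to
each other, but only finiteness is used later. -/
theorem exists_eLpNorm_fourierSynthesis_le : ∃ K : ℝ≥0∞, K ≠ ∞ ∧ ∀ f : ℝ → ℂ, Integrable f →
    MemLp f 2 volume → AEStronglyMeasurable (fourierSynthesis f) volume ∧
      eLpNorm (fourierSynthesis f) 2 volume ≤ K * eLpNorm f 2 volume := by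
  have ha : (2 * Real.pi)⁻¹ ≠ 0 := inv_ne_zero Real.two_pi_pos.ne'
  refine ⟨‖((Real.sqrt (2 * Real.pi))⁻¹ : ℂ)‖ₑ * ENNReal.ofReal (2 * Real.pi) ^ (1 / (2 : ℝ)),
    ENNReal.mul_ne_top enorm_ne_top (ENNReal.rpow_ne_top_of_nonneg (by norm_num)
      ENNReal.ofReal_ne_top), fun f hf hf2 => ?_⟩
  have hm := aestronglyMeasurable_fourierInv hf
  have hs : fourierSynthesis f = ((Real.sqrt (2 * Real.pi))⁻¹ : ℂ) •
      (FourierTransformInv.fourierInv f ∘ fun x : ℝ => x * (2 * Real.pi)⁻¹) := by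
    funext x
    exact fourierSynthesis_eq f x
  have hmap : Measure.map (fun x : ℝ => x * (2 * Real.pi)⁻¹) volume =
      ENNReal.ofReal (2 * Real.pi) • (volume : Measure ℝ) := by
    rw [Real.map_volume_mul_right ha, inv_inv, abs_of_pos Real.two_pi_pos]
  rw [hs]
  refine ⟨(hm.comp_quasiMeasurePreserving (quasiMeasurePreserving_mul_const ha)).const_smul _, ?_⟩
  rw [eLpNorm_const_smul, ← eLpNorm_map_measure (by rw [hmap]; exact hm.smul_measure _)
    (by fun_prop), hmap, eLpNorm_smul_measure_of_ne_top (by norm_num), eLpNorm_fourierInv hf hf2,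
    mul_assoc]
  simp

theorem cardinalWellDefined {φ : ℝ → ℂ} (h1 : CondA1 φ) (h2 : CondA2 φ) :
    CardinalWellDefined φ where
  symbol_summable := by
    refine ae_of_ae_torus ?_
    filter_upwards [ae_isRegularAt h1 h2] with ξ hξ k
    have h3 := (Equiv.addLeft k).summable_iff.2 hξ.summable.of_norm
    refine h3.congr fun j => ?_
    simp only [Function.comp_apply, Equiv.coe_addLeft]
    congr 1
    push_cast
    ring
  symbol_ne_zero := by
    refine ae_of_ae_torus ?_
    filter_upwards [ae_isRegularAt h1 h2] with ξ hξ k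
    rw [hξ.symbol_eq]
    exact_mod_cast hξ.tsum_pos.ne'
  integrable_hat := integrable_cardinalHat h1 h2
  memLp_two := by
    obtain ⟨K, hK, h⟩ := exists_eLpNorm_fourierSynthesis_le
    obtain ⟨hm, hle⟩ := h _ (integrable_cardinalHat h1 h2) (memLp_cardinalHat h1 h2)
    exact ⟨hm, hle.trans_lt (ENNReal.mul_lt_top hK.lt_top (memLp_cardinalHat h1 h2).2)⟩

/-! ### The operators as multiplication operators -/

/-- An essentially bounded multiplier keeps the product in `L₂`, so the default value `0` is never
taken. -/
theorem mulOp_ae_eq {m : ℝ → ℂ} (hm : Measurable m) {C : ℝ} (hC : ∀ᵐ ξ ∂torus, ‖m ξ‖ ≤ C)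
    (g : L2T) : mulOp m g =ᵐ[torus] fun ξ => m ξ * g ξ := by
  have h : MemLp (fun ξ => m ξ * g ξ) 2 torus :=
    (Lp.memLp g).mul (p := ∞) (memLp_top_of_bound hm.aestronglyMeasurable C hC)
  rw [mulOp, dif_pos h]
  exact h.coeFn_toLp

theorem opM_ae_eq {φ : ℝ → ℂ} (h1 : CondA1 φ) (h2 : CondA2 φ) (g : L2T) :
    opM φ g =ᵐ[torus] fun ξ => ((delta φ).toReal : ℂ) / fhat φ ξ * g ξ := by
  refine mulOp_ae_eq ((measurable_fhat φ).const_div _) (C := 1) ?_ g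
  filter_upwards [ae_isRegularAt h1 h2] with ξ hξ
  rw [norm_div, Complex.norm_real, Real.norm_of_nonneg ENNReal.toReal_nonneg]
  exact div_le_one_of_le₀ hξ.delta_le (norm_nonneg _)

theorem opT_ae_eq {φ : ℝ → ℂ} (h1 : CondA1 φ) (h2 : CondA2 φ) (k : ℤ) (g : L2T) :
    opT φ k g =ᵐ[torus]
      fun ξ => ((delta φ).toReal : ℂ)⁻¹ * fhat φ (ξ + 2 * Real.pi * k) * g ξ := by
  refine mulOp_ae_eq (((measurable_fhat φ).comp (by fun_prop)).const_mul _)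
    (C := (delta φ).toReal⁻¹ * (blockSup (fhat φ) k).toReal) ?_ g
  have hb : blockSup (fhat φ) k ≠ ∞ := ((ENNReal.le_tsum k).trans_lt h2.1).ne
  filter_upwards [ae_isRegularAt h1 h2] with ξ hξ
  rw [norm_mul, norm_inv, Complex.norm_real, Real.norm_of_nonneg ENNReal.toReal_nonneg,
    Function.comp_apply, ← toReal_enorm (fhat φ _)]
  gcongr
  exact hξ.le_blockSup k

/-! ### Comparison of two cardinal functions -/

theorem summable_abs_div_sub_div {a b : ℤ → ℝ} (ha : Summable a) (hb : Summable b) (x y : ℝ) :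
    Summable fun k => |a k / x - b k / y| :=
  ((ha.div_const x).sub (hb.div_const y)).abs

/-- Normalizing two nonnegative sequences by their sums instead of by a term increases their `ℓ₁`
distance at most by the factor `2`. -/
theorem tsum_abs_div_tsum_sub_le {a b : ℤ → ℝ} (ha : Summable a) (hb : Summable b)
    (ha0 : ∀ k, 0 ≤ a k) (hb0 : ∀ k, 0 ≤ b k) {i : ℤ} (hai : 0 < a i) (hbi : 0 < b i) :
    ∑' k, |a k / (∑' j, a j) - b k / ∑' j, b j| ≤ 2 * ∑' k, |a k / a i - b k / b i| := by
  set P := ∑' j, a j with hP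
  set Q := ∑' j, b j with hQ
  set E := ∑' k, |a k / a i - b k / b i| with hE
  have hE0 : 0 ≤ E := tsum_nonneg fun k => abs_nonneg _
  have haP : a i ≤ P := ha.le_tsum i fun j _ => ha0 j
  have hbQ : b i ≤ Q := hb.le_tsum i fun j _ => hb0 j
  have hP0 : 0 < P := hai.trans_le haP
  have hQ0 : 0 < Q := hbi.trans_le hbQ
  have hsE := summable_abs_div_sub_div ha hb (a i) (b i)
  have hPQ : |Q / b i - P / a i| ≤ E := by
    have : P / a i - Q / b i = ∑' k, (a k / a i - b k / b i) := by
      rw [(ha.div_const _).tsum_sub (hb.div_const _), tsum_div_const, tsum_div_const]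
    rw [abs_sub_comm, this]
    have := norm_tsum_le_tsum_norm (f := fun k => a k / a i - b k / b i) hsE
    exact this
  have hterm : ∀ k, |a k / P - b k / Q| ≤
      |a k / a i - b k / b i| * (a i / P) + b k * (E * (a i / P) / Q) := by
    intro k
    -- Change the numerator ratio first and the normalization second. The second error is governed
    -- by `Q / b i - P / a i`, itself a sum of ratio differences; each part contributes `E * (a i /
    -- P) ≤ E`.
    have e : a k / P - b k / Q = (a k / a i - b k / b i) * (a i / P) +
        b k * ((Q / b i - P / a i) * (a i / P) / Q) := by
      field_simp
      ring
    rw [e]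
    refine (abs_add_le _ _).trans ?_
    rw [abs_mul, abs_mul (b k), abs_div (_ * _), abs_mul (_ - _), abs_of_nonneg (hb0 k),
      abs_of_pos hQ0, abs_of_pos (div_pos hai hP0)]
    have h1 : 0 ≤ a i / P := (div_pos hai hP0).le
    have h2 := hb0 k
    gcongr
  calc _ ≤ ∑' k, (|a k / a i - b k / b i| * (a i / P) + b k * (E * (a i / P) / Q)) :=
        (summable_abs_div_sub_div ha hb P Q).tsum_le_tsum hterm
          ((hsE.mul_right _).add (hb.mul_right _))
    _ = 2 * E * (a i / P) := by
        rw [(hsE.mul_right _).tsum_add (hb.mul_right _), tsum_mul_right, tsum_mul_right, ← hQ,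
          ← hE]
        field_simp
        ring
    _ ≤ 2 * E * 1 := by
        gcongr
        exact div_le_one_of_le₀ haP hP0.le
    _ = 2 * E := mul_one _

theorem IsRegularAt.tsum_enorm_cardinalHat_sub_le {φ ψ : ℝ → ℂ} {ξ : ℝ} (hφ : IsRegularAt φ ξ)
    (hψ : IsRegularAt ψ ξ) :
    ∑' k : ℤ, ‖cardinalHat φ (ξ + 2 * Real.pi * k) - cardinalHat ψ (ξ + 2 * Real.pi * k)‖ₑ ≤
      ENNReal.ofReal (Real.sqrt (2 * Real.pi))⁻¹ * (2 * ∑' k : {k : ℤ // k ≠ 0},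
        ‖fhat φ (ξ + 2 * Real.pi * (k : ℤ)) / fhat φ ξ -
          fhat ψ (ξ + 2 * Real.pi * (k : ℤ)) / fhat ψ ξ‖ₑ) := by
  set a : ℤ → ℝ := fun k => ‖fhat φ (ξ + 2 * Real.pi * k)‖ with ha
  set b : ℤ → ℝ := fun k => ‖fhat ψ (ξ + 2 * Real.pi * k)‖ with hb
  have hφ0 : fhat φ ξ = (a 0 : ℂ) := by simpa [ha] using hφ.eq_norm 0
  have hψ0 : fhat ψ ξ = (b 0 : ℂ) := by simpa [hb] using hψ.eq_norm 0
  have ha0 : 0 < a 0 := by simpa [ha] using hφ.pos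
  have hb0 : 0 < b 0 := by simpa [hb] using hψ.pos
  have hc0 : 0 ≤ (Real.sqrt (2 * Real.pi))⁻¹ := inv_nonneg.2 sqrt_two_pi_pos.le
  have h1 : ∀ k : ℤ, ‖cardinalHat φ (ξ + 2 * Real.pi * k) -
      cardinalHat ψ (ξ + 2 * Real.pi * k)‖ₑ =
      ENNReal.ofReal (Real.sqrt (2 * Real.pi))⁻¹ *
        ENNReal.ofReal |a k / (∑' j, a j) - b k / ∑' j, b j| := by
    intro k
    rw [hφ.cardinalHat_eq, hψ.cardinalHat_eq, ← Complex.ofReal_sub, ← mul_sub, ← ofReal_norm,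
      Complex.norm_real, norm_mul, Real.norm_of_nonneg hc0, ENNReal.ofReal_mul hc0, Real.norm_eq_abs]
  have h2 : ∀ k : ℤ, ‖fhat φ (ξ + 2 * Real.pi * k) / fhat φ ξ -
      fhat ψ (ξ + 2 * Real.pi * k) / fhat ψ ξ‖ₑ =
      ENNReal.ofReal |a k / a 0 - b k / b 0| := by
    intro k
    rw [hφ.eq_norm k, hψ.eq_norm k, hφ0, hψ0, ← Complex.ofReal_div, ← Complex.ofReal_div,
      ← Complex.ofReal_sub, ← ofReal_norm, Complex.norm_real, Real.norm_eq_abs]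
  -- At `k = 0` both ratios are `1`, so omitting that index loses nothing.
  have h3 : ∑' k : {k : ℤ // k ≠ 0}, ENNReal.ofReal |a k / a 0 - b k / b 0| =
      ∑' k : ℤ, ENNReal.ofReal |a k / a 0 - b k / b 0| := by
    refine tsum_subtype_eq_of_support_subset
      (f := fun k : ℤ => ENNReal.ofReal |a k / a 0 - b k / b 0|) (s := {k : ℤ | k ≠ 0}) ?_
    intro k hk hk0
    subst hk0
    simp [div_self ha0.ne', div_self hb0.ne'] at hk
  simp_rw [h1, h2]
  rw [h3, ENNReal.tsum_mul_left]
  gcongr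
  rw [← ENNReal.ofReal_tsum_of_nonneg (fun k => abs_nonneg _)
      (summable_abs_div_sub_div hφ.summable hψ.summable _ _),
    ← ENNReal.ofReal_tsum_of_nonneg (fun k => abs_nonneg _)
      (summable_abs_div_sub_div hφ.summable hψ.summable _ _),
    ← ENNReal.ofReal_ofNat 2, ← ENNReal.ofReal_mul zero_le_two]
  exact ENNReal.ofReal_le_ofReal (tsum_abs_div_tsum_sub_le hφ.summable hψ.summable
    (fun k => norm_nonneg _) (fun k => norm_nonneg _) ha0 hb0)

/-- The constant function `1` on the torus. -/
def oneT : L2T := (memLp_const (1 : ℂ)).toLp fun _ => (1 : ℂ)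

/-- The quantity in condition (B3) for `X = ℤ` and one generator `φ`, tested on `1`. -/
def multiplierDefect (ψ φ : ℝ → ℂ) : ℝ≥0∞ := ∑' k : {k : ℤ // k ≠ 0},
  ‖opT ψ k (prolongation intSeq k (opM ψ oneT - opM φ oneT))‖ₑ

/-- The quantity in condition (B4) for `X = Y = ℤ` and one generator `φ`, tested on `1`. -/
def translateDefect (ψ φ : ℝ → ℂ) : ℝ≥0∞ := ∑' k : {k : ℤ // k ≠ 0},
  ‖opT φ k (prolongation intSeq k (opM φ oneT)) - opT ψ k (prolongation intSeq k (opM φ oneT))‖ₑ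

theorem lintegral_enorm_le_enorm (u : L2T) :
    ∫⁻ ξ, ‖u ξ‖ₑ ∂torus ≤ ‖u‖ₑ * torus Set.univ ^ (1 / 2 : ℝ) := by
  have h := eLpNorm_le_eLpNorm_mul_rpow_measure_univ (p := 1) (q := 2) (μ := torus)
    (by norm_num) (Lp.aestronglyMeasurable u)
  rw [eLpNorm_one_eq_lintegral_enorm, ← Lp.enorm_def] at h
  convert h using 3
  norm_num

theorem lintegral_ratio_sub_le {φ ψ : ℝ → ℂ} (hφ1 : CondA1 φ) (hφ2 : CondA2 φ) (hψ1 : CondA1 ψ)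
    (hψ2 : CondA2 ψ) (k : ℤ) :
    ∫⁻ ξ, ‖fhat φ (ξ + 2 * Real.pi * k) / fhat φ ξ -
        fhat ψ (ξ + 2 * Real.pi * k) / fhat ψ ξ‖ₑ ∂torus ≤
      (‖opT ψ k (prolongation intSeq k (opM ψ oneT - opM φ oneT))‖ₑ +
        ‖opT φ k (prolongation intSeq k (opM φ oneT)) -
          opT ψ k (prolongation intSeq k (opM φ oneT))‖ₑ) * torus Set.univ ^ (1 / 2 : ℝ) := by
  simp_rw [prolongation_intSeq]
  set u := opT ψ k (opM ψ oneT - opM φ oneT)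
  set v := opT φ k (opM φ oneT) - opT ψ k (opM φ oneT)
  have hone : oneT =ᵐ[torus] fun _ => (1 : ℂ) := MemLp.coeFn_toLp _
  have hδφ : ((delta φ).toReal : ℂ) ≠ 0 := by
    exact_mod_cast (ENNReal.toReal_pos hφ2.2.1.ne' (delta_ne_top hφ2)).ne'
  have hδψ : ((delta ψ).toReal : ℂ) ≠ 0 := by
    exact_mod_cast (ENNReal.toReal_pos hψ2.2.1.ne' (delta_ne_top hψ2)).ne'
  -- In `v - u` the terms `T_ψ M_φ 1` cancel, leaving `T_φ M_φ 1 - T_ψ M_ψ 1`.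
  have hae : (v - u : L2T) =ᵐ[torus] fun ξ => fhat φ (ξ + 2 * Real.pi * k) / fhat φ ξ -
      fhat ψ (ξ + 2 * Real.pi * k) / fhat ψ ξ := by
    filter_upwards [hone, Lp.coeFn_sub v u, opT_ae_eq hψ1 hψ2 k (opM ψ oneT - opM φ oneT),
      Lp.coeFn_sub (opT φ k (opM φ oneT)) (opT ψ k (opM φ oneT)),
      opT_ae_eq hφ1 hφ2 k (opM φ oneT), opT_ae_eq hψ1 hψ2 k (opM φ oneT),
      Lp.coeFn_sub (opM ψ oneT) (opM φ oneT), opM_ae_eq hφ1 hφ2 oneT, opM_ae_eq hψ1 hψ2 oneT,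
      ae_isRegularAt hφ1 hφ2, ae_isRegularAt hψ1 hψ2]
      with ξ e0 e1 e2 e3 e4 e5 e6 e7 e8 r1 r2
    have hφ0 : fhat φ ξ ≠ 0 := norm_pos_iff.1 r1.pos
    have hψ0 : fhat ψ ξ ≠ 0 := norm_pos_iff.1 r2.pos
    simp only [e1, Pi.sub_apply, u, v, e2, e3, e4, e5, e6, e7, e8, e0]
    field_simp
    ring
  refine (lintegral_congr_ae (hae.fun_comp (‖·‖ₑ))).symm.trans_le ?_
  refine (lintegral_enorm_le_enorm (v - u)).trans ?_
  gcongr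
  rw [add_comm]
  exact enorm_sub_le

/-- The constant in `lintegral_cardinalHat_sub_le`. -/
def comparisonConst : ℝ≥0∞ :=
  ENNReal.ofReal (Real.sqrt (2 * Real.pi))⁻¹ * 2 * torus Set.univ ^ (1 / 2 : ℝ)

theorem comparisonConst_ne_top : comparisonConst ≠ ∞ :=
  ENNReal.mul_ne_top (ENNReal.mul_ne_top ENNReal.ofReal_ne_top (by norm_num))
    (ENNReal.rpow_ne_top_of_nonneg (by norm_num) (measure_ne_top _ _))

theorem lintegral_cardinalHat_sub_le {φ ψ : ℝ → ℂ} (hφ1 : CondA1 φ) (hφ2 : CondA2 φ)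
    (hψ1 : CondA1 ψ) (hψ2 : CondA2 ψ) :
    ∫⁻ ξ, ‖cardinalHat φ ξ - cardinalHat ψ ξ‖ₑ ≤
      comparisonConst * (multiplierDefect ψ φ + translateDefect ψ φ) := by
  have hm : ∀ k : {k : ℤ // k ≠ 0}, AEMeasurable (fun ξ : ℝ =>
      ‖fhat φ (ξ + 2 * Real.pi * (k : ℤ)) / fhat φ ξ -
          fhat ψ (ξ + 2 * Real.pi * (k : ℤ)) / fhat ψ ξ‖ₑ) torus := by
    intro k
    have := measurable_fhat φ
    have := measurable_fhat ψ
    exact Measurable.aemeasurable (by fun_prop)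
  rw [lintegral_enorm_eq_lintegral_tsum (f := fun ξ => cardinalHat φ ξ - cardinalHat ψ ξ)
    ((aestronglyMeasurable_cardinalHat hφ1 hφ2).sub (aestronglyMeasurable_cardinalHat hψ1 hψ2))]
  calc _ ≤ ∫⁻ ξ, ENNReal.ofReal (Real.sqrt (2 * Real.pi))⁻¹ * (2 * ∑' k : {k : ℤ // k ≠ 0},
        ‖fhat φ (ξ + 2 * Real.pi * (k : ℤ)) / fhat φ ξ -
          fhat ψ (ξ + 2 * Real.pi * (k : ℤ)) / fhat ψ ξ‖ₑ) ∂torus := by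
        refine lintegral_mono_ae ?_
        filter_upwards [ae_isRegularAt hφ1 hφ2, ae_isRegularAt hψ1 hψ2] with ξ h1 h2
        exact h1.tsum_enorm_cardinalHat_sub_le h2
    _ = ENNReal.ofReal (Real.sqrt (2 * Real.pi))⁻¹ * (2 * ∑' k : {k : ℤ // k ≠ 0},
        ∫⁻ ξ, ‖fhat φ (ξ + 2 * Real.pi * (k : ℤ)) / fhat φ ξ -
          fhat ψ (ξ + 2 * Real.pi * (k : ℤ)) / fhat ψ ξ‖ₑ ∂torus) := by
        rw [lintegral_const_mul' _ _ ENNReal.ofReal_ne_top,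
          lintegral_const_mul' _ _ (by norm_num), lintegral_tsum hm]
    _ ≤ ENNReal.ofReal (Real.sqrt (2 * Real.pi))⁻¹ * (2 * ∑' k : {k : ℤ // k ≠ 0},
        (‖opT ψ k (prolongation intSeq k (opM ψ oneT - opM φ oneT))‖ₑ +
        ‖opT φ k (prolongation intSeq k (opM φ oneT)) -
          opT ψ k (prolongation intSeq k (opM φ oneT))‖ₑ) * torus Set.univ ^ (1 / 2 : ℝ)) := by
        gcongr with k
        exact lintegral_ratio_sub_le hφ1 hφ2 hψ1 hψ2 k
    _ = comparisonConst * (multiplierDefect ψ φ + translateDefect ψ φ) := by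
        rw [ENNReal.tsum_mul_right, ENNReal.tsum_add, comparisonConst, multiplierDefect,
          translateDefect]
        ring

theorem tendsto_lintegral_cardinalHat_sub {A : Type*} [Preorder A] {ψ : ℝ → ℂ} {φ : A → ℝ → ℂ}
    (hψ1 : CondA1 ψ) (hψ2 : CondA2 ψ) (hφ : CondB intSeq intSeq ψ φ) :
    Tendsto (fun α => ∫⁻ ξ, ‖cardinalHat (φ α) ξ - cardinalHat ψ ξ‖ₑ) atTop (𝓝 0) := by
  have h : Tendsto (fun α => comparisonConst * (multiplierDefect ψ (φ α) +
      translateDefect ψ (φ α))) atTop (𝓝 0) := by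
    have h1 := ENNReal.Tendsto.const_mul (a := comparisonConst)
      ((hφ.b3 oneT).add (hφ.b4 oneT)) (Or.inr comparisonConst_ne_top)
    rwa [add_zero, mul_zero] at h1
  exact tendsto_of_tendsto_of_tendsto_of_le_of_le tendsto_const_nhds h (fun _ => zero_le)
    fun α => lintegral_cardinalHat_sub_le (hφ.b1 α).1 (hφ.b1 α).2 hψ1 hψ2

theorem cardinalFunction_sub {φ ψ : ℝ → ℂ} (hφ1 : CondA1 φ) (hφ2 : CondA2 φ)
    (hψ1 : CondA1 ψ) (hψ2 : CondA2 ψ) (x : ℝ) : cardinalFunction φ x - cardinalFunction ψ x =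
      fourierSynthesis (fun ξ => cardinalHat φ ξ - cardinalHat ψ ξ) x :=
  fourierSynthesis_sub (integrable_cardinalHat hφ1 hφ2) (integrable_cardinalHat hψ1 hψ2) x

theorem tendstoUniformly_cardinalFunction {A : Type*} [Preorder A] {ψ : ℝ → ℂ} {φ : A → ℝ → ℂ}
    (hψ1 : CondA1 ψ) (hψ2 : CondA2 ψ) (hφ : CondB intSeq intSeq ψ φ) :
    TendstoUniformly (fun α => cardinalFunction (φ α)) (cardinalFunction ψ) atTop := by
  have h := ENNReal.Tendsto.const_mul (a := ‖((Real.sqrt (2 * Real.pi))⁻¹ : ℂ)‖ₑ)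
    (tendsto_lintegral_cardinalHat_sub hψ1 hψ2 hφ) (Or.inr enorm_ne_top)
  rw [mul_zero] at h
  rw [EMetric.tendstoUniformly_iff]
  intro ε hε
  filter_upwards [h.eventually (gt_mem_nhds hε)] with α hα x
  rw [edist_comm, edist_eq_enorm_sub,
    cardinalFunction_sub (hφ.b1 α).1 (hφ.b1 α).2 hψ1 hψ2]
  exact (enorm_fourierSynthesis_le _ x).trans_lt hα

theorem tendsto_eLpNorm_cardinalFunction {A : Type*} [Preorder A] {ψ : ℝ → ℂ} {φ : A → ℝ → ℂ}
    (hψ1 : CondA1 ψ) (hψ2 : CondA2 ψ) (hφ : CondB intSeq intSeq ψ φ) :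
    Tendsto (fun α => eLpNorm (fun x => cardinalFunction (φ α) x - cardinalFunction ψ x) 2 volume)
      atTop (𝓝 0) := by
  obtain ⟨K, hK, hsyn⟩ := exists_eLpNorm_fourierSynthesis_le
  have h1 : Tendsto (fun α => K *
      (∫⁻ ξ, ‖cardinalHat (φ α) ξ - cardinalHat ψ ξ‖ₑ) ^ (1 / 2 : ℝ)) atTop (𝓝 0) := by
    have h2 := ENNReal.Tendsto.const_mul (a := K)
      ((tendsto_lintegral_cardinalHat_sub hψ1 hψ2 hφ).ennrpow_const (1 / 2)) (Or.inr hK)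
    rwa [ENNReal.zero_rpow_of_pos (by norm_num), mul_zero] at h2
  refine tendsto_of_tendsto_of_tendsto_of_le_of_le tendsto_const_nhds h1 (fun _ => zero_le)
    fun α => ?_
  obtain ⟨hα1, hα2⟩ := hφ.b1 α
  simp_rw [cardinalFunction_sub hα1 hα2 hψ1 hψ2]
  refine (hsyn _ ((integrable_cardinalHat hα1 hα2).sub (integrable_cardinalHat hψ1 hψ2))
    ((memLp_cardinalHat hα1 hα2).sub (memLp_cardinalHat hψ1 hψ2))).2.trans ?_
  gcongr
  refine eLpNorm_two_le_of_norm_le_one ?_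
  filter_upwards [ae_norm_cardinalHat_le hα1 hα2, ae_norm_cardinalHat_le hψ1 hψ2] with ξ h3 h4
  exact (norm_sub_le _ _).trans (by linarith)

end

end CardinalInterpolation

theorem mainTheorem12 {A : Type*} [Preorder A] (ψ : ℝ → ℂ) (φ : A → ℝ → ℂ)
    (hψ1 : CardinalInterpolation.CondA1 ψ) (hψ2 : CardinalInterpolation.CondA2 ψ)
    (hφ : CardinalInterpolation.CondB CardinalInterpolation.intSeq CardinalInterpolation.intSeq ψ φ) :
    CardinalInterpolation.CardinalWellDefined ψ ∧
    (∀ α, CardinalInterpolation.CardinalWellDefined (φ α)) ∧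
    TendstoUniformly (fun α => CardinalInterpolation.cardinalFunction (φ α))
      (CardinalInterpolation.cardinalFunction ψ) atTop ∧
    Tendsto (fun α => eLpNorm (fun x => CardinalInterpolation.cardinalFunction (φ α) x -
      CardinalInterpolation.cardinalFunction ψ x) 2 volume) atTop (𝓝 0) :=
  ⟨CardinalInterpolation.cardinalWellDefined hψ1 hψ2,
    fun α => CardinalInterpolation.cardinalWellDefined (hφ.b1 α).1 (hφ.b1 α).2,
    CardinalInterpolation.tendstoUniformly_cardinalFunction hψ1 hψ2 hφ,
    CardinalInterpolation.tendsto_eLpNorm_cardinalFunction hψ1 hψ2 hφ⟩
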